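/- Let $p$ be a prime, let $n,\ell\ge 1$ and $m\ge 3$ be integers, put $q=p^{\ell}$ and assume $q>3$. Let $R=\mathrm{GR}(p^n,\ell)$ be the Galois ring of characteristic $p^n$ with $p^{n\ell}$ elements, i.e. a finite commutative ring of this characteristic and cardinality whose zero divisors together with $0$ form the ideal $(p)$. For $x\in R^m$ let $w(x)$ be the Hamming weight of $x$, the number of its nonzero components, and let $U(R)$ be the group of units of $R$. Let $f:R^m\to R$ be a function such that 1. if $1\le w(x)\le 2$, then $f(ux)=f(x)\in U(R)$ for all $u\in U(R)$; 2. if $w(x)=m$ and at least two components of $x$ are units, then $f(x)=0$; 3. if $w(x)=m$, exactly one component of $x$ is a unit, and all other components of $x$ are of the form $p^r u_j$ with one common exponent $r$ and units $u_j\in U(R)$, then $f(x)=p^r$. Let $C_f$ be the linear code of all words $c(a,v)=\big(a f(x)+v\cdot x\big)_{x\in R^m\setminus\{0\}}$ with $a\in R$, $v\in R^m$, where $v\cdot x=\sum_i v_ix_i$. Then $C_f$ is minimal: whenever $c,c'\in C_f$ are nonzero and $\operatorname{Supp}(c')\subseteq\operatorname{Supp}(c)$, there is a nonzero $a\in R$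 with $c'=ac$. -/

import Mathlib

namespace GaloisCode

/-- `R` is the Galois ring of characteristic `p ^ n` and cardinality `p ^ (n * l)`: a finite
commutative ring in which the zero divisors, together with `0`, form the principal ideal
generated by `p`. -/
structure IsGaloisRing (p n l : ℕ) (R : Type*) [CommRing R] : Prop where
  finite : Finite R
  char : CharP R (p ^ n)
  card : Nat.card R = p ^ (n * l)
  zeroDivisors : {x : R | x = 0 ∨ ∃ y : R, y ≠ 0 ∧ x * y = 0} = (Ideal.span {(p : R)} : Set R)

/-- A codeword `c` of the linear code `C` is minimal if it is nonzero and every nonzero codeword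
whose support is contained in the support of `c` is a scalar multiple of `c`, by a nonzero
scalar. -/
def IsMinimalCodeword {R ι : Type*} [CommRing R] (C : Submodule R (ι → R)) (c : ι → R) : Prop :=
  c ∈ C ∧ c ≠ 0 ∧
    ∀ c' ∈ C, c' ≠ 0 → Function.support c' ⊆ Function.support c → ∃ a : R, a ≠ 0 ∧ c' = a • c

/-- A linear code is minimal if all its nonzero codewords are minimal. -/
def IsMinimalCode {R ι : Type*} [CommRing R] (C : Submodule R (ι → R)) : Prop :=
  ∀ c ∈ C, c ≠ 0 → IsMinimalCodeword C c

/-- The word `c(a, v) = (a f(x) + v · x)`, indexed by the nonzero `x ∈ R ^ m`. -/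
def word {R : Type*} [CommRing R] {m : ℕ} (f : (Fin m → R) → R) (a : R) (v : Fin m → R) :
    {x : Fin m → R // x ≠ 0} → R :=
  fun x => a * f x.1 + v ⬝ᵥ x.1

/-- The linear code `C_f` of all words `c(a, v)`. -/
def functionCode {R : Type*} [CommRing R] {m : ℕ} (f : (Fin m → R) → R) :
    Submodule R ({x : Fin m → R // x ≠ 0} → R) where
  carrier := {c | ∃ (a : R) (v : Fin m → R), c = word f a v}
  zero_mem' := ⟨0, 0, by ext x; simp [word]⟩
  add_mem' := by
    rintro _ _ ⟨a, v, rfl⟩ ⟨b, w, rfl⟩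
    refine ⟨a + b, v + w, ?_⟩
    ext x
    simp only [word, Pi.add_apply, add_dotProduct]
    ring
  smul_mem' := by
    rintro r _ ⟨a, v, rfl⟩
    refine ⟨r * a, r • v, ?_⟩
    ext x
    simp only [word, Pi.smul_apply, smul_eq_mul, smul_dotProduct]
    ring

end GaloisCode

namespace GaloisCode

open Finset

/-! Support inclusion says that zeros of `c(a, v)` are zeros of `c(b, w)`; the task is to deduce
`(b, w) = c • (a, v)`. With `π = p`, write `a = π ^ s * α` and `v = π ^ t • v'`, where `v' k` is a
unit. If `a = 0`, low-weight zeros come in unit multiples sharing one unit value of `f`, which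
forces `b = 0` and makes `w` a multiple of `v` (`ZerosSubset.exists_smul_of_eq_zero`). If `t ≤ s`,
low-weight vectors with `v ⬝ᵥ x` associated to `a` can be scaled to zeros; they give `a ∣ b`, and
after subtracting a multiple, `w` (`ZerosSubset.exists_smul_of_le`). If `s < t`, full-weight vectors
with two units, where `f = 0`, determine `w`; after subtracting, one vector with a single unit
controls `b` (`ZerosSubset.exists_smul_of_lt`). -/

/-- `π` is nilpotent of index `n`, and every nonzero element is a power of `π` times a unit. -/
structure IsChainUniformizer {R : Type*} [CommRing R] (π : R) (n : ℕ) : Prop where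
  pow_eq_zero_iff : ∀ i : ℕ, π ^ i = 0 ↔ n ≤ i
  exists_eq : ∀ x : R, x ≠ 0 → ∃ (r : ℕ) (u : Rˣ), x = π ^ r * u

/-! ### Galois rings as chain rings -/

section GaloisRing

variable {p n l : ℕ} {R : Type*} [CommRing R]

theorem IsGaloisRing.pow_eq_zero_iff (hR : IsGaloisRing p n l R) (hp : p.Prime) (i : ℕ) :
    (p : R) ^ i = 0 ↔ n ≤ i := by
  have := hR.char
  rw [← Nat.cast_pow, CharP.cast_eq_zero_iff R (p ^ n), Nat.pow_dvd_pow_iff_le_right hp.one_lt]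

theorem IsGaloisRing.isUnit_or_dvd (hR : IsGaloisRing p n l R) (x : R) :
    IsUnit x ∨ (p : R) ∣ x := by
  have := hR.finite
  by_cases hx : (p : R) ∣ x
  · exact Or.inr hx
  · left
    have h : x ∉ {x : R | x = 0 ∨ ∃ y : R, y ≠ 0 ∧ x * y = 0} := by
      rw [hR.zeroDivisors]
      simpa [Ideal.mem_span_singleton] using hx
    simp only [Set.mem_ofPred_eq, not_or, not_exists, not_and] at h
    have hinj : Function.Injective (fun y : R => x * y) := by
      intro y z hyz
      by_contra hne
      exact h.2 (y - z) (sub_ne_zero.2 hne) (by simpa [mul_sub, sub_eq_zero] using hyz)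
    obtain ⟨y, hy⟩ := (Finite.injective_iff_surjective.1 hinj) 1
    exact IsUnit.of_mul_eq_one y hy

theorem IsGaloisRing.isChainUniformizer (hR : IsGaloisRing p n l R) (hp : p.Prime) :
    IsChainUniformizer (p : R) n := by
  refine ⟨hR.pow_eq_zero_iff hp, fun x hx => ?_⟩
  by_contra! hne
  have key : ∀ i : ℕ, (p : R) ^ i ∣ x := by
    intro i
    induction i with
    | zero => simp
    | succ i ih =>
      obtain ⟨y, rfl⟩ := ih
      rcases hR.isUnit_or_dvd y with ⟨u, rfl⟩ | ⟨z, rfl⟩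
      · exact (hne i u rfl).elim
      · exact ⟨z, by ring⟩
  have := key n
  rw [(hR.pow_eq_zero_iff hp n).2 le_rfl, zero_dvd_iff] at this
  exact hx this

/-- If the residue field had at most two elements, the ring would have at most `2 ^ n`. -/
theorem IsGaloisRing.exists_isUnit_sub_one (hR : IsGaloisRing p n l R) (hp : p.Prime)
    (hn : 1 ≤ n) (hq : 3 < p ^ l) : ∃ u : Rˣ, IsUnit ((u : R) - 1) := by
  classical
  by_contra! hne
  have hdig : ∀ x : R, ∃ e : R, (e = 0 ∨ e = 1) ∧ (p : R) ∣ x - e := by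
    intro x
    rcases hR.isUnit_or_dvd x with ⟨u, rfl⟩ | h
    · exact ⟨1, Or.inr rfl, (hR.isUnit_or_dvd _).resolve_left (hne u)⟩
    · exact ⟨0, Or.inl rfl, by simpa using h⟩
  -- Truncated `p`-adic expansions with digits 0 and 1.
  have key : ∀ i : ℕ, ∃ S : Finset R, #S ≤ 2 ^ i ∧
      ∀ x : R, ∃ y ∈ S, (p : R) ^ i ∣ x - y := by
    intro i
    induction i with
    | zero => exact ⟨{0}, by simp, fun x => ⟨0, by simp, by simp⟩⟩
    | succ i ih =>
      obtain ⟨S, hS, h⟩ := ih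
      refine ⟨S ∪ S.image (· + (p : R) ^ i), ?_, fun x => ?_⟩
      · have h₁ := card_union_le S (S.image (· + (p : R) ^ i))
        have h₂ := card_image_le (s := S) (f := (· + (p : R) ^ i))
        rw [pow_succ]
        omega
      · obtain ⟨y, hy, z, hz⟩ := h x
        obtain ⟨e, he, t, ht⟩ := hdig z
        refine ⟨y + e * (p : R) ^ i, ?_, t, by linear_combination hz + (p : R) ^ i * ht⟩
        rcases he with rfl | rfl
        · simpa using Or.inl hy
        · simpa using Or.inr hy
  obtain ⟨S, hS, h⟩ := key n
  have hall : ∀ x : R, x ∈ S := by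
    intro x
    obtain ⟨y, hy, hxy⟩ := h x
    rw [(hR.pow_eq_zero_iff hp n).2 le_rfl, zero_dvd_iff, sub_eq_zero] at hxy
    exact hxy ▸ hy
  have := hR.finite
  have := Fintype.ofFinite R
  have hcard : Nat.card R ≤ 2 ^ n := by
    rw [Nat.card_eq_fintype_card, ← Finset.card_univ]
    exact (card_le_card fun x _ => hall x).trans hS
  rw [hR.card, mul_comm, pow_mul] at hcard
  have := (Nat.pow_le_pow_iff_left (by omega : n ≠ 0)).1 hcard
  omega

end GaloisRing

/-! ### Arithmetic of chain rings -/

namespace IsChainUniformizer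

variable {R : Type*} [CommRing R] {π : R} {n : ℕ}

theorem isUnit_add (h : IsChainUniformizer π n) {u : R} (hu : IsUnit u) {r : ℕ} (hr : r ≠ 0)
    (y : R) : IsUnit (u + π ^ r * y) := by
  have hnil : IsNilpotent (π ^ r * y) :=
    (Commute.all _ _).isNilpotent_mul_right
      (IsNilpotent.pow_of_pos ⟨n, (h.pow_eq_zero_iff n).2 le_rfl⟩ hr)
  exact hnil.isUnit_add_left_of_commute hu (Commute.all _ _)

theorem not_isUnit_pow (h : IsChainUniformizer π n) [Nontrivial R] {r : ℕ} (hr : r ≠ 0) :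
    ¬ IsUnit (π ^ r) := by
  have hnil : IsNilpotent (π ^ r) :=
    IsNilpotent.pow_of_pos ⟨n, (h.pow_eq_zero_iff n).2 le_rfl⟩ hr
  exact fun hu => by
    obtain ⟨i, hi⟩ := hnil
    exact not_isUnit_zero (hi ▸ hu.pow i)

/-- The annihilator of `π ^ i` is generated by `π ^ (n - i)`. -/
theorem exists_of_pow_mul_eq_zero (h : IsChainUniformizer π n) {i : ℕ} {x : R}
    (hx : π ^ i * x = 0) : ∃ y, x = π ^ (n - i) * y := by
  by_cases hx0 : x = 0
  · exact ⟨0, by simp [hx0]⟩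
  obtain ⟨r, u, rfl⟩ := h.exists_eq x hx0
  rw [← mul_assoc, ← pow_add, Units.mul_left_eq_zero, h.pow_eq_zero_iff] at hx
  refine ⟨π ^ (r - (n - i)) * u, ?_⟩
  rw [← mul_assoc, ← pow_add]
  congr 2
  omega

/-- A nonzero vector is a power of `π` times a vector with a unit component. -/
theorem exists_eq_smul (h : IsChainUniformizer π n) {m : ℕ} {v : Fin m → R} (hv : v ≠ 0) :
    ∃ (t : ℕ) (v' : Fin m → R) (k : Fin m) (g : R), t < n ∧ v' k * g = 1 ∧ v = π ^ t • v' := by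
  by_contra! hne
  have key : ∀ i ≤ n, ∃ v' : Fin m → R, v = π ^ i • v' := by
    intro i
    induction i with
    | zero => exact fun _ => ⟨v, by simp⟩
    | succ i ih =>
      intro hi
      obtain ⟨v', hv'⟩ := ih (by omega)
      have : ∀ k, ∃ y, v' k = π * y := by
        intro k
        by_cases hk : v' k = 0
        · exact ⟨0, by simp [hk]⟩
        obtain ⟨r, u, hu⟩ := h.exists_eq _ hk
        cases r with
        | zero => exact (hne i v' k ((u⁻¹ : Rˣ) : R) (by omega) (by simp [hu]) hv').elim
        | succ r => exact ⟨π ^ r * u, by rw [hu]; ring⟩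
      choose y hy using this
      refine ⟨y, ?_⟩
      rw [hv']
      ext k
      simp only [Pi.smul_apply, smul_eq_mul, hy]
      ring
  obtain ⟨v', hv'⟩ := key n le_rfl
  rw [(h.pow_eq_zero_iff n).2 le_rfl, zero_smul] at hv'
  exact hv hv'

/-- If `w` is the multiple of `v'` by `w k * g` and `π ^ (n - t)` kills `w k`, then `w` is a
multiple of `π ^ t • v'`. -/
theorem exists_eq_smul_of_proportional (h : IsChainUniformizer π n) {m t : ℕ} (ht : t ≤ n)
    {v' w : Fin m → R} {k : Fin m} {g : R}
    (hw : ∀ j, w j = w k * g * v' j) (hk : π ^ (n - t) * w k = 0) :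
    ∃ c : R, w = c • (π ^ t • v') := by
  obtain ⟨y, hy⟩ := h.exists_of_pow_mul_eq_zero hk
  rw [Nat.sub_sub_self ht] at hy
  refine ⟨y * g, ?_⟩
  ext j
  rw [hw j, hy]
  simp only [Pi.smul_apply, smul_eq_mul]
  ring

end IsChainUniformizer

/-! ### Comparing zeros of words -/

section Words

variable {R : Type*} [CommRing R] {m : ℕ}

/-- Every zero of the word `c(a, v)` is a zero of the word `c(b, w)`. -/
def ZerosSubset (f : (Fin m → R) → R) (a : R) (v : Fin m → R) (b : R) (w : Fin m → R) : Prop :=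
  ∀ x : Fin m → R, x ≠ 0 → a * f x + v ⬝ᵥ x = 0 → b * f x + w ⬝ᵥ x = 0

/-- Permits normalising `b` or `w` to zero once it is known to be a multiple. -/
theorem ZerosSubset.sub_smul {f : (Fin m → R) → R} {a b : R} {v w : Fin m → R}
    (h : ZerosSubset f a v b w) (c : R) : ZerosSubset f a v (b - c * a) (w - c • v) := by
  intro x hx h0
  rw [sub_dotProduct, smul_dotProduct, smul_eq_mul]
  linear_combination h x hx h0 - c * h0

theorem exists_smul_of_sub_smul {a b c : R} {v w : Fin m → R}
    (h : ∃ d : R, b - c * a = d * a ∧ w - c • v = d • v) : ∃ d : R, b = d * a ∧ w = d • v := by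
  obtain ⟨d, h₁, h₂⟩ := h
  refine ⟨d + c, by linear_combination h₁, ?_⟩
  rw [add_smul, ← h₂, sub_add_cancel]

theorem dotProduct_add_single (v y : Fin m → R) (k : Fin m) (c : R) :
    v ⬝ᵥ (y + Pi.single k c) = v ⬝ᵥ y + v k * c := by
  rw [dotProduct_add, dotProduct_single]

/-- Changing one entry of the all-ones vector to `u` keeps all entries units and isolates `d j * (u
- 1)`. -/
theorem eq_zero_of_forall_units_dotProduct {d : Fin m → R} {u : Rˣ} (hu : IsUnit ((u : R) - 1))
    (h : ∀ y : Fin m → R, (∀ i, IsUnit (y i)) → d ⬝ᵥ y = 0) : d = 0 := by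
  ext j
  have e₁ := h 1 (fun i => by simp)
  have e₂ := h (1 + Pi.single j ((u : R) - 1)) (fun i => by
    by_cases hi : i = j
    · subst hi
      simp
    · simp [hi])
  rw [dotProduct_add_single, e₁, zero_add] at e₂
  exact hu.mul_left_eq_zero.1 e₂

theorem units_smul_ne_zero {x : Fin m → R} (hx : x ≠ 0) (u : Rˣ) : (u : R) • x ≠ 0 := by
  intro h
  exact hx (by simpa [smul_smul] using congrArg (((u⁻¹ : Rˣ) : R) • ·) h)

variable [DecidableEq R]

/-- `f` takes unit values on vectors of weight one and two, and is invariant there under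
multiplication by units. -/
def UnitOnLowWeight (f : (Fin m → R) → R) : Prop :=
  ∀ x : Fin m → R, 1 ≤ hammingNorm x → hammingNorm x ≤ 2 →
    IsUnit (f x) ∧ ∀ u : Rˣ, f ((u : R) • x) = f x

theorem hammingNorm_single_add_single_le (j k : Fin m) (α β : R) :
    hammingNorm (Pi.single j α + Pi.single k β : Fin m → R) ≤ 2 := by
  refine (card_le_card (t := {j, k}) fun i hi => ?_).trans card_le_two
  by_contra hne
  simp only [mem_insert, mem_singleton, not_or] at hne
  simp [hne.1, hne.2] at hi

theorem hammingNorm_eq_of_forall_ne_zero {x : Fin m → R} (hx : ∀ i, x i ≠ 0) :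
    hammingNorm x = m := by
  simp [hammingNorm, hx]

/-! ### The case `a = 0` -/

variable {f : (Fin m → R) → R} {a b : R} {v w : Fin m → R} {π : R} {n : ℕ}

theorem UnitOnLowWeight.apply (hf : UnitOnLowWeight f) {x : Fin m → R} (hx : x ≠ 0)
    (h2 : hammingNorm x ≤ 2) : ∃ φ : Rˣ, f x = φ ∧ ∀ u : Rˣ, f ((u : R) • x) = φ := by
  obtain ⟨⟨φ, hφ⟩, h⟩ := hf x (hammingNorm_pos_iff.2 hx) h2
  exact ⟨φ, hφ.symm, fun u => (h u).trans hφ.symm⟩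

/-- Both `x` and `u • x` are zeros with the same value of `f`; subtracting leaves `(u - 1) * w ⬝ᵥ x
= 0`. -/
theorem ZerosSubset.low_weight_of_eq_zero (hf : UnitOnLowWeight f)
    (h : ZerosSubset f 0 v b w) {u : Rˣ} (hu : IsUnit ((u : R) - 1)) {x : Fin m → R} (hx : x ≠ 0)
    (h2 : hammingNorm x ≤ 2) (hvx : v ⬝ᵥ x = 0) : b = 0 ∧ w ⬝ᵥ x = 0 := by
  obtain ⟨φ, hφ, hφu⟩ := hf.apply hx h2
  have e₁ := h x hx (by simp [hvx])
  have e₂ := h _ (units_smul_ne_zero hx u) (by simp [hvx])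
  rw [hφ] at e₁
  rw [hφu, dotProduct_smul, smul_eq_mul] at e₂
  have hw : w ⬝ᵥ x = 0 := by
    refine hu.mul_right_eq_zero.1 ?_
    linear_combination e₂ - e₁
  rw [hw, add_zero, Units.mul_left_eq_zero] at e₁
  exact ⟨e₁, hw⟩

theorem ZerosSubset.exists_smul_of_eq_zero (hf : UnitOnLowWeight f)
    (h : ZerosSubset f 0 v b w) (hπ : IsChainUniformizer π n) (hm : 3 ≤ m) {u : Rˣ}
    (hu : IsUnit ((u : R) - 1)) (hv : v ≠ 0) : ∃ c : R, b = c * 0 ∧ w = c • v := by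
  have : Nontrivial R := by
    obtain ⟨i, hi⟩ := Function.ne_iff.1 hv
    exact ⟨_, _, hi⟩
  obtain ⟨t, v', k, g, ht, hg, rfl⟩ := hπ.exists_eq_smul hv
  have hpair : ∀ j, j ≠ k → b = 0 ∧ w j = w k * g * v' j := by
    intro j hj
    have hx : (Pi.single j 1 + Pi.single k (-(g * v' j)) : Fin m → R) ≠ 0 := by
      intro h0
      simpa [hj] using congrFun h0 j
    obtain ⟨hb, hw⟩ := h.low_weight_of_eq_zero hf hu hx
      (hammingNorm_single_add_single_le _ _ _ _) (by
        rw [dotProduct_add_single, dotProduct_single]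
        simp only [Pi.smul_apply, smul_eq_mul]
        linear_combination - π ^ t * v' j * hg)
    rw [dotProduct_add_single, dotProduct_single] at hw
    exact ⟨hb, by linear_combination hw⟩
  have hb : b = 0 := by
    have : Nontrivial (Fin m) := Fin.nontrivial_iff_two_le.2 (by omega)
    obtain ⟨j, hj⟩ := exists_ne k
    exact (hpair j hj).1
  have hk : π ^ (n - t) * w k = 0 := by
    by_cases h0 : π ^ (n - t) = 0
    · simp [h0]
    have hx : (Pi.single k 0 + Pi.single k (π ^ (n - t)) : Fin m → R) ≠ 0 := by
      intro h1
      exact h0 (by simpa using congrFun h1 k)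
    obtain ⟨-, hw⟩ := h.low_weight_of_eq_zero hf hu hx
      (hammingNorm_single_add_single_le _ _ _ _) (by
        have hz : π ^ t * π ^ (n - t) = 0 := by
          rw [← pow_add, hπ.pow_eq_zero_iff]; omega
        rw [dotProduct_add_single, dotProduct_single]
        simp only [Pi.smul_apply, smul_eq_mul]
        linear_combination v' k * hz)
    rw [dotProduct_add_single, dotProduct_single] at hw
    linear_combination hw
  have hw : ∀ j, w j = w k * g * v' j := by
    intro j
    by_cases hj : j = k
    · subst hj
      linear_combination - w j * hg
    · exact (hpair j hj).2
  obtain ⟨c, hc⟩ := hπ.exists_eq_smul_of_proportional ht.le hw hk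
  exact ⟨c, by simp [hb], hc⟩

/-! ### The case `t ≤ s` -/

/-- A vector of weight one or two at which `v` is associated to `a` can be scaled to a zero. -/
theorem ZerosSubset.low_weight (hf : UnitOnLowWeight f) (h : ZerosSubset f a v b w)
    {x : Fin m → R} (hx : x ≠ 0) (h2 : hammingNorm x ≤ 2) {ε : Rˣ} (hvx : v ⬝ᵥ x = a * ε) :
    ∃ φ u : Rˣ,
      ∀ δ : R, IsUnit (u + δ) → δ * a = 0 → b * φ + (u + δ) * w ⬝ᵥ x = 0 := by
  obtain ⟨φ, hφ, hφu⟩ := hf.apply hx h2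
  have hu : (φ : R) + ((-(φ * ε⁻¹) : Rˣ) : R) * ε = 0 := by simp
  -- The scalar solves `a * φ + u * a * ε = 0`; adding an annihilator `δ` of `a` preserves this.
  refine ⟨φ, -(φ * ε⁻¹), fun δ ⟨η, hη⟩ hδ => ?_⟩
  have e := h _ (units_smul_ne_zero hx η) (by
    rw [hφu, dotProduct_smul, smul_eq_mul, hvx, hη]
    linear_combination a * hu + ε * hδ)
  rwa [hφu, dotProduct_smul, smul_eq_mul, hη] at e

theorem ZerosSubset.exists_smul_of_le (hf : UnitOnLowWeight f) (hπ : IsChainUniformizer π n)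
    {s t : ℕ} (hts : t ≤ s) (hs : s < n) {α : Rˣ} {v' : Fin m → R} {k : Fin m} {g : R}
    (hg : v' k * g = 1) (h : ZerosSubset f (π ^ s * α) (π ^ t • v') b w) :
    ∃ c : R, b = c * (π ^ s * α) ∧ w = c • (π ^ t • v') := by
  have ha : π ^ s ≠ 0 := fun h0 => by
    have := (hπ.pow_eq_zero_iff s).1 h0
    omega
  have hpow : π ^ t * π ^ (s - t) = π ^ s := by rw [← pow_add]; congr 1; omega
  -- The entry added at `k` is solved from `v' ⬝ᵥ x = π ^ (s - t)`.
  have hgen : ∀ (j : Fin m) (β : R),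
      (Pi.single j β + Pi.single k (g * (π ^ (s - t) - v' j * β)) : Fin m → R) ≠ 0 ∧
      (π ^ t • v') ⬝ᵥ (Pi.single j β + Pi.single k (g * (π ^ (s - t) - v' j * β)))
        = π ^ s * α * (α⁻¹ : Rˣ) := by
    intro j β
    have e : (π ^ t • v') ⬝ᵥ (Pi.single j β + Pi.single k (g * (π ^ (s - t) - v' j * β)))
        = π ^ s := by
      rw [dotProduct_add_single, dotProduct_single]
      simp only [Pi.smul_apply, smul_eq_mul]
      linear_combination π ^ t * (π ^ (s - t) - v' j * β) * hg + hpow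
    refine ⟨fun h0 => ha ?_, by rw [e]; simp⟩
    rw [← e, h0, dotProduct_zero]
  have hb : ∃ c, b = c * (π ^ s * α) := by
    obtain ⟨hx, hvx⟩ := hgen k 0
    obtain ⟨φ, u, hδ⟩ := h.low_weight hf hx (hammingNorm_single_add_single_le _ _ _ _) hvx
    rcases Nat.eq_zero_or_pos s with rfl | hs0
    · exact ⟨b * (α⁻¹ : Rˣ), by simp [mul_assoc]⟩
    have hz : π ^ (n - s) * π ^ s = 0 := by
      rw [← pow_add, hπ.pow_eq_zero_iff]; omega
    have e₁ := hδ 0 (by simp) (by simp)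
    -- Perturbing the scalar by an annihilator of `a` shows `π ^ s ∣ d`, hence `π ^ s ∣ b`.
    have e₂ := hδ (π ^ (n - s)) (by
      simpa using hπ.isUnit_add u.isUnit (by omega : n - s ≠ 0) 1)
      (by linear_combination α * hz)
    set d := w ⬝ᵥ (Pi.single k 0 + Pi.single k (g * (π ^ (s - t) - v' k * 0)))
    have hd0 : π ^ (n - s) * d = 0 := by linear_combination e₂ - e₁
    obtain ⟨y, hy⟩ := hπ.exists_of_pow_mul_eq_zero hd0
    rw [Nat.sub_sub_self hs.le] at hy
    have hα : (α : R) * (α⁻¹ : Rˣ) = 1 := by simp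
    have hφ' : (φ : R) * (φ⁻¹ : Rˣ) = 1 := by simp
    refine ⟨-(u * y * (φ⁻¹ : Rˣ) * (α⁻¹ : Rˣ)), ?_⟩
    linear_combination (φ⁻¹ : Rˣ) * e₁ - b * hφ' - u * (φ⁻¹ : Rˣ) * hy
      + u * y * (φ⁻¹ : Rˣ) * π ^ s * hα
  obtain ⟨c, hc⟩ := hb
  refine exists_smul_of_sub_smul (c := c) ?_
  replace h := h.sub_smul c
  rw [hc, sub_self] at h ⊢
  set w' := w - c • (π ^ t • v')
  have hgen' : ∀ (j : Fin m) (β : R),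
      w' j * β + w' k * (g * (π ^ (s - t) - v' j * β)) = 0 := by
    intro j β
    obtain ⟨hx, hvx⟩ := hgen j β
    obtain ⟨φ, u, hδ⟩ := h.low_weight hf hx (hammingNorm_single_add_single_le _ _ _ _) hvx
    have e := hδ 0 (by simp) (by simp)
    rw [add_zero, zero_mul, zero_add, Units.mul_right_eq_zero, dotProduct_add_single,
      dotProduct_single] at e
    exact e
  have hk : π ^ (s - t) * w' k = 0 := by
    linear_combination v' k * hgen' k 0 - w' k * π ^ (s - t) * hg
  have hprop : ∀ j, w' j = w' k * g * v' j := by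
    intro j
    linear_combination hgen' j 1 - g * hk
  obtain ⟨d, hd⟩ := hπ.exists_eq_smul_of_proportional (by omega : t ≤ n) hprop (by
    have : π ^ (n - t) = π ^ (n - s) * π ^ (s - t) := by rw [← pow_add]; congr 1; omega
    rw [this, mul_assoc, hk, mul_zero])
  refine ⟨d, ?_, hd⟩
  -- It remains to see that `d` kills `a`: `hk` gives `d * π ^ s = π ^ (s - t) * w' k * g = 0`.
  have hdk : w' k = d * (π ^ t * v' k) := by
    conv_lhs => rw [hd]
    rfl
  linear_combination - α * g * hk + π ^ (s - t) * α * g * hdk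
    + d * α * π ^ t * π ^ (s - t) * hg + d * α * hpow

/-! ### The case `s < t` -/

/-- `f` vanishes on vectors without zero components that have at least two unit components. -/
def VanishesOnTwoUnits (f : (Fin m → R) → R) : Prop :=
  ∀ x : Fin m → R, hammingNorm x = m →
    (∃ i j : Fin m, i ≠ j ∧ IsUnit (x i) ∧ IsUnit (x j)) → f x = 0

/-- Altering only entry `k` leaves at least two unit entries, so `f` still vanishes if the new entry
is nonzero. -/
theorem ZerosSubset.of_units (hf : VanishesOnTwoUnits f) (h : ZerosSubset f a v b w) (hm : 3 ≤ m)
    [Nontrivial R] {y : Fin m → R} (hy : ∀ i, IsUnit (y i)) {k : Fin m} {c : R}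
    (hc : y k + c ≠ 0) (hv : v ⬝ᵥ y + v k * c = 0) : w ⬝ᵥ y + w k * c = 0 := by
  obtain ⟨i, hi, j, hj, hij⟩ := (one_lt_card (s := univ.erase k)).1 (by
    rw [card_erase_of_mem (mem_univ k), card_univ, Fintype.card_fin]; omega)
  rw [mem_erase] at hi hj
  have hother : ∀ i ≠ k, (y + Pi.single k c : Fin m → R) i = y i := by
    intro i hi
    simp [hi]
  have hne : ∀ i, (y + Pi.single k c : Fin m → R) i ≠ 0 := by
    intro i
    by_cases hik : i = k
    · subst hik
      simpa using hc
    · rw [hother i hik]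
      exact (hy i).ne_zero
  have h0 := hf _ (hammingNorm_eq_of_forall_ne_zero hne) ⟨i, j, hij, by
    rw [hother i hi.1]; exact hy i, by rw [hother j hj.1]; exact hy j⟩
  have e := h (y + Pi.single k c) (fun hz => hne k (by rw [hz]; rfl)) (by
    rw [h0, dotProduct_add_single, hv, mul_zero, zero_add])
  rwa [h0, dotProduct_add_single, mul_zero, zero_add] at e

theorem ZerosSubset.exists_eq_smul_of_units (hf : VanishesOnTwoUnits f)
    (hπ : IsChainUniformizer π n) (hm : 3 ≤ m) [Nontrivial R] {u : Rˣ}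
    (hu : IsUnit ((u : R) - 1)) {t : ℕ} (ht0 : t ≠ 0) (ht : t ≤ n) {v' : Fin m → R} {k : Fin m}
    {g : R} (hg : v' k * g = 1) (h : ZerosSubset f a (π ^ t • v') b w) :
    ∃ c : R, w = c • (π ^ t • v') := by
  have hz : π ^ t * π ^ (n - t) = 0 := by rw [← pow_add, hπ.pow_eq_zero_iff]; omega
  have hP : π ^ (n - t) ≠ 0 := fun h0 => by
    have := (hπ.pow_eq_zero_iff _).1 h0
    omega
  have hgu : IsUnit g := IsUnit.of_mul_eq_one (v' k) (by rw [mul_comm, hg])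
  -- Entry `k` is adjusted so that `v' ⬝ᵥ x = π ^ (n - t) * z`, which `π ^ t` kills.
  have key : ∀ y : Fin m → R, (∀ i, IsUnit (y i)) → ∀ z : R,
      y k + g * (π ^ (n - t) * z - v' ⬝ᵥ y) ≠ 0 →
      (w - (w k * g) • v') ⬝ᵥ y + w k * g * (π ^ (n - t) * z) = 0 := by
    intro y hy z hne
    have e := h.of_units hf hm hy hne (by
      rw [smul_dotProduct]
      simp only [Pi.smul_apply, smul_eq_mul]
      linear_combination π ^ t * (π ^ (n - t) * z - v' ⬝ᵥ y) * hg + z * hz)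
    rw [sub_dotProduct, smul_dotProduct, smul_eq_mul]
    linear_combination e
  have hdiff : ∀ (y : Fin m → R) (z z' : R), IsUnit (z' - z) →
      y k + g * (π ^ (n - t) * z - v' ⬝ᵥ y) = 0 →
      y k + g * (π ^ (n - t) * z' - v' ⬝ᵥ y) ≠ 0 := by
    intro y z z' hu' h₁ h₂
    refine hP (hu'.mul_left_eq_zero.1 (hgu.mul_right_eq_zero.1 ?_))
    linear_combination h₂ - h₁
  -- Among 0, 1, `u`, whose differences are units, at most one makes entry `k` zero.
  have hpair : ∀ y : Fin m → R, ∃ z z' : R, IsUnit (z' - z) ∧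
      y k + g * (π ^ (n - t) * z - v' ⬝ᵥ y) ≠ 0 ∧
      y k + g * (π ^ (n - t) * z' - v' ⬝ᵥ y) ≠ 0 := by
    intro y
    by_cases h₀ : y k + g * (π ^ (n - t) * 0 - v' ⬝ᵥ y) = 0
    · exact ⟨1, u, hu, hdiff y 0 1 (by simp) h₀, hdiff y 0 u (by simp) h₀⟩
    by_cases h₁ : y k + g * (π ^ (n - t) * 1 - v' ⬝ᵥ y) = 0
    · exact ⟨0, u, by simp, h₀, hdiff y 1 u hu h₁⟩
    · exact ⟨0, 1, by simp, h₀, h₁⟩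
  have hk : π ^ (n - t) * w k = 0 := by
    obtain ⟨z, z', hu', hne, hne'⟩ := hpair 1
    have e := key 1 (by simp) z hne
    have e' := key 1 (by simp) z' hne'
    refine hu'.mul_left_eq_zero.1 (hgu.mul_right_eq_zero.1 ?_)
    linear_combination e' - e
  have hd : w - (w k * g) • v' = 0 := by
    refine eq_zero_of_forall_units_dotProduct hu fun y hy => ?_
    obtain ⟨z, -, -, hne, -⟩ := hpair y
    linear_combination key y hy z hne - g * z * hk
  exact hπ.exists_eq_smul_of_proportional ht
    (fun j => by simpa using congrFun (sub_eq_zero.1 hd) j) hk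

/-- `f` has value `π ^ r` on vectors without zero components that have a single unit component
and whose other components are associated to `π ^ r`. -/
def PowOnOneUnit (π : R) (f : (Fin m → R) → R) : Prop :=
  ∀ (x : Fin m → R) (r : ℕ), hammingNorm x = m → (∃! i : Fin m, IsUnit (x i)) →
    (∀ j : Fin m, ¬ IsUnit (x j) → ∃ u : Rˣ, x j = π ^ r * (u : R)) → f x = π ^ r

theorem PowOnOneUnit.apply (hf : PowOnOneUnit π f) (hπ : IsChainUniformizer π n) [Nontrivial R]
    {r : ℕ} (hr0 : r ≠ 0) (hrn : r < n) {k : Fin m} {c : R} (hc : IsUnit (π ^ r + c)) :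
    (fun _ => π ^ r) + (Pi.single k c : Fin m → R) ≠ 0 ∧
      f ((fun _ => π ^ r) + Pi.single k c) = π ^ r := by
  set x : Fin m → R := (fun _ => π ^ r) + Pi.single k c with hx
  have hk : x k = π ^ r + c := by simp [hx]
  have hj : ∀ j ≠ k, x j = π ^ r := fun j hj => by simp [hx, hj]
  have hne : ∀ i, x i ≠ 0 := by
    intro i
    by_cases hi : i = k
    · subst hi
      rw [hk]
      exact hc.ne_zero
    · rw [hj i hi, Ne, hπ.pow_eq_zero_iff]
      omega
  refine ⟨fun h0 => hne k (by rw [h0]; rfl), hf x r (hammingNorm_eq_of_forall_ne_zero hne)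
    ⟨k, by simpa [hk] using hc, fun i hi => ?_⟩ fun j hju => ⟨1, ?_⟩⟩
  · by_contra hik
    simp only [hj i hik] at hi
    exact hπ.not_isUnit_pow hr0 hi
  · rw [hj j (fun hjk => hju (by rw [hjk, hk]; exact hc)), Units.val_one, mul_one]

theorem ZerosSubset.exists_smul_of_lt (hf₂ : VanishesOnTwoUnits f) (hf₁ : PowOnOneUnit π f)
    (hπ : IsChainUniformizer π n) (hm : 3 ≤ m) [Nontrivial R] {u : Rˣ}
    (hu : IsUnit ((u : R) - 1)) {s t : ℕ} (hst : s < t) (ht : t ≤ n) {α : Rˣ} {v' : Fin m → R}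
    {k : Fin m} {g : R} (hg : v' k * g = 1)
    (h : ZerosSubset f (π ^ s * α) (π ^ t • v') b w) :
    ∃ c : R, b = c * (π ^ s * α) ∧ w = c • (π ^ t • v') := by
  obtain ⟨c, hc⟩ := h.exists_eq_smul_of_units hf₂ hπ hm hu (by omega) ht hg
  refine exists_smul_of_sub_smul (c := c) ?_
  replace h := h.sub_smul c
  rw [hc, sub_self] at h ⊢
  set b' := b - c * (π ^ s * α)
  have hα : (α : R) * (α⁻¹ : Rˣ) = 1 := by simp
  have hpow : π ^ s * π ^ (t - s) = π ^ t := by rw [← pow_add]; congr 1; omega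
  have hb : π ^ (t - s) * b' = 0 := by
    by_cases hr : t - s < n
    · have hgu : IsUnit g := IsUnit.of_mul_eq_one (v' k) (by rw [mul_comm, hg])
      set S := v' ⬝ᵥ (fun _ => π ^ (t - s)) with hS
      have hS' : S = π ^ (t - s) * v' ⬝ᵥ 1 := by
        rw [hS, ← smul_eq_mul, ← dotProduct_smul]
        congr 1
        ext
        simp
      -- This entry at `k` makes `v' ⬝ᵥ x = -α`, so `v ⬝ᵥ x` cancels `a * π ^ (t - s)`; it is a
      -- unit, being `-g * α` modulo `π`.
      have hcu : IsUnit (π ^ (t - s) + g * (-α - S)) := by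
        have e := hπ.isUnit_add (hgu.mul α.isUnit).neg (by omega : t - s ≠ 0) (1 - g * v' ⬝ᵥ 1)
        rw [hS']
        convert e using 1
        ring
      obtain ⟨hx, hfx⟩ := hf₁.apply hπ (by omega : t - s ≠ 0) hr hcu
      have e := h _ hx (by
        rw [hfx, smul_dotProduct, dotProduct_add_single, ← hS, smul_eq_mul]
        linear_combination α * hpow + π ^ t * (-α - S) * hg)
      rw [hfx, zero_dotProduct, add_zero] at e
      rw [mul_comm, e]
    · rw [(hπ.pow_eq_zero_iff _).2 (by omega), zero_mul]
  obtain ⟨y, hy⟩ := hπ.exists_of_pow_mul_eq_zero hb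
  have hpow' : π ^ (n - (t - s)) = π ^ (n - t) * π ^ s := by rw [← pow_add]; congr 1; omega
  have hz : π ^ (n - t) * π ^ t = 0 := by rw [← pow_add, hπ.pow_eq_zero_iff]; omega
  -- The factor `π ^ (n - t)` kills `v`, so this multiple changes only the first coordinate.
  refine ⟨π ^ (n - t) * y * (α⁻¹ : Rˣ), ?_, ?_⟩
  · linear_combination hy + y * hpow' - π ^ (n - t) * π ^ s * y * hα
  · rw [smul_smul, mul_right_comm, mul_right_comm (π ^ (n - t)), hz, zero_mul, zero_mul, zero_smul]

theorem ZerosSubset.exists_smul (hf₀ : UnitOnLowWeight f) (hf₂ : VanishesOnTwoUnits f)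
    (hf₁ : PowOnOneUnit π f) (hπ : IsChainUniformizer π n) (hm : 3 ≤ m) {u : Rˣ}
    (hu : IsUnit ((u : R) - 1)) (hav : a ≠ 0 ∨ v ≠ 0) (h : ZerosSubset f a v b w) :
    ∃ c : R, b = c * a ∧ w = c • v := by
  by_cases ha : a = 0
  · subst ha
    exact h.exists_smul_of_eq_zero hf₀ hπ hm hu (hav.resolve_left (by simp))
  have : Nontrivial R := ⟨_, _, ha⟩
  obtain ⟨s, α, rfl⟩ := hπ.exists_eq a ha
  have hs : s < n := by
    by_contra hs
    rw [(hπ.pow_eq_zero_iff s).2 (by omega), zero_mul] at ha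
    exact ha rfl
  obtain ⟨t, v', k, g, ht, hg, rfl⟩ : ∃ (t : ℕ) (v' : Fin m → R) (k : Fin m) (g : R),
      t ≤ n ∧ v' k * g = 1 ∧ v = π ^ t • v' := by
    by_cases hv : v = 0
    -- For `v = 0`, taking `t = n` places it in the case `s < t`.
    · exact ⟨n, 1, ⟨0, by omega⟩, 1, le_rfl, by simp,
        by rw [hv, (hπ.pow_eq_zero_iff n).2 le_rfl, zero_smul]⟩
    · obtain ⟨t, v', k, g, ht, hg, hv⟩ := hπ.exists_eq_smul hv
      exact ⟨t, v', k, g, ht.le, hg, hv⟩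
  rcases le_or_gt t s with hts | hst
  · exact h.exists_smul_of_le hf₀ hπ hts hs hg
  · exact h.exists_smul_of_lt hf₂ hf₁ hπ hm hu hst ht hg

end Words

end GaloisCode

theorem mainTheorem12 (p n l m : ℕ) (hp : p.Prime) (hn : 1 ≤ n) (hl : 1 ≤ l)
    (hq : 3 < p ^ l) (hm : 3 ≤ m)
    (R : Type*) [CommRing R] [DecidableEq R] (hR : GaloisCode.IsGaloisRing p n l R)
    (f : (Fin m → R) → R)
    (h1 : ∀ x : Fin m → R, 1 ≤ hammingNorm x → hammingNorm x ≤ 2 →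
      IsUnit (f x) ∧ ∀ u : Rˣ, f ((u : R) • x) = f x)
    (h3 : ∀ x : Fin m → R, hammingNorm x = m →
      (∃ i j : Fin m, i ≠ j ∧ IsUnit (x i) ∧ IsUnit (x j)) → f x = 0)
    (h4 : ∀ (x : Fin m → R) (r : ℕ), hammingNorm x = m → (∃! i : Fin m, IsUnit (x i)) →
      (∀ j : Fin m, ¬ IsUnit (x j) → ∃ u : Rˣ, x j = (p : R) ^ r * (u : R)) →
      f x = (p : R) ^ r) :
    GaloisCode.IsMinimalCode (GaloisCode.functionCode f) := by
  have hπ := hR.isChainUniformizer hp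
  obtain ⟨u, hu⟩ := hR.exists_isUnit_sub_one hp hn hq
  rintro _ ⟨a, v, rfl⟩ hc
  refine ⟨⟨a, v, rfl⟩, hc, ?_⟩
  rintro _ ⟨b, w, rfl⟩ hc' hsupp
  have hav : a ≠ 0 ∨ v ≠ 0 := by
    by_contra! h0
    refine hc ?_
    ext x
    simp [GaloisCode.word, h0.1, h0.2]
  have hz : GaloisCode.ZerosSubset f a v b w := by
    intro x hx h0
    by_contra hne
    exact hsupp (a := ⟨x, hx⟩) hne h0
  obtain ⟨c, rfl, rfl⟩ := hz.exists_smul h1 h3 h4 hπ hm hu hav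
  have hword : GaloisCode.word f (c * a) (c • v) = c • GaloisCode.word f a v := by
    ext x
    simp only [GaloisCode.word, Pi.smul_apply, smul_eq_mul, smul_dotProduct]
    ring
  refine ⟨c, ?_, hword⟩
  rintro rfl
  exact hc' (by rw [hword, zero_smul])
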